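/- Let $m$ be the normalized Haar measure on the unit circle $\mathbb T$. For a complex Banach space $X$, let $\widetilde H^1(X)$ be the closure in $L^1(\mathbb T,m;X)$ of the $X$-valued analytic polynomials $\sum_{k=0}^{N} z^k x_k$ ($N\ge 0$, $x_k\in X$), and let $H^1=\widetilde H^1(\mathbb C)$. Let $H^1\hat\otimes X$ be the projective tensor product, i.e. the completion of $H^1\otimes X$ for the norm $\|u\|_\wedge=\inf\{\sum_k\|h_k\|\,\|x_k\| : u=\sum_k h_k\otimes x_k\}$ (finite sums), and consider the canonical map $H^1\hat\otimes X\to\widetilde H^1(X)$ induced by $h\otimes x\mapsto h(\cdot)x$. The $H^1$-projectivity constant $\eta(X)\in[0,\infty]$ is the smallest constant $c$ such that $$\|F\|_{H^1\hat\otimes X}\le c\,\|F\|_{\widetilde H^1(X)}\qquad\text{for all }F\in H^1\hat\otimes X,$$ with $\eta(X)=\infty$ if there is no such $c$. For Banach spaces $E,F$, let $d(E,F)=\inf\|T\|\,\|T^{-1}\|$ be the Banach–Mazur distance, the infimum being over all isomorphisms $T:E\to F$. Let $\ell_n^p$ be $\mathbb C^n$ with the $\ell^p$ norm. **Proposition.**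 For every $p\in[1,\infty]$ and every integer $n\ge 1$, with $r=\min(2,p)$, $$\tfrac12\,n^{1-1/r}\ \le\ \eta(\ell_n^p)\ \le\ d(\ell_n^p,\ell_n^1)\ \le\ n^{1-1/r}.$$ -/

import Mathlib

open MeasureTheory
open scoped TensorProduct ENNReal NNReal

noncomputable section

namespace H1Projective

/-! ### The projective tensor product -/

section ProjectiveTensor

variable (E F : Type*) [NormedAddCommGroup E] [NormedSpace ℂ E]
  [NormedAddCommGroup F] [NormedSpace ℂ F]

/-- The algebraic tensor product of two complex normed spaces, to be equipped with the
projective norm. -/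
def AlgTensor : Type _ := E ⊗[ℂ] F

instance : AddCommGroup (AlgTensor E F) := inferInstanceAs (AddCommGroup (E ⊗[ℂ] F))

instance : Module ℂ (AlgTensor E F) := inferInstanceAs (Module ℂ (E ⊗[ℂ] F))

variable {E F}

/-- The elementary tensor `x ⊗ y`. -/
def AlgTensor.tmul (x : E) (y : F) : AlgTensor E F := x ⊗ₜ[ℂ] y

/-- All the numbers `∑ ‖x_k‖ ‖y_k‖` given by the representations `u = ∑ x_k ⊗ y_k`. -/
def AlgTensor.costs (u : AlgTensor E F) : Set ℝ :=
  {s | ∃ (m : ℕ) (x : Fin m → E) (y : Fin m → F),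
    u = ∑ k, AlgTensor.tmul (x k) (y k) ∧ s = ∑ k, ‖x k‖ * ‖y k‖}

/-- The projective norm on the algebraic tensor product. -/
instance : Norm (AlgTensor E F) := ⟨fun u => sInf u.costs⟩

theorem AlgTensor.norm_def (u : AlgTensor E F) : ‖u‖ = sInf u.costs := rfl

theorem AlgTensor.costs_nonneg (u : AlgTensor E F) : ∀ s ∈ u.costs, 0 ≤ s := by
  rintro s ⟨m, x, y, -, rfl⟩
  positivity

theorem AlgTensor.costs_bddBelow (u : AlgTensor E F) : BddBelow u.costs :=
  ⟨0, u.costs_nonneg⟩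

theorem AlgTensor.costs_add {u v : AlgTensor E F} {s t : ℝ} (hs : s ∈ u.costs)
    (ht : t ∈ v.costs) : s + t ∈ (u + v).costs := by
  obtain ⟨m, x, y, rfl, rfl⟩ := hs
  obtain ⟨m', x', y', rfl, rfl⟩ := ht
  refine ⟨m + m', Fin.append x x', Fin.append y y', ?_, ?_⟩ <;> simp [Fin.sum_univ_add]

theorem AlgTensor.costs_smul {u : AlgTensor E F} (c : ℂ) {s : ℝ} (hs : s ∈ u.costs) :
    ‖c‖ * s ∈ (c • u).costs := by
  obtain ⟨m, x, y, rfl, rfl⟩ := hs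
  refine ⟨m, fun k => c • x k, y, ?_, ?_⟩
  · rw [Finset.smul_sum]
    exact Finset.sum_congr rfl fun k _ => TensorProduct.smul_tmul' c (x k) (y k)
  · simp [norm_smul, Finset.mul_sum, mul_assoc]

theorem AlgTensor.costs_nonempty (u : AlgTensor E F) : u.costs.Nonempty := by
  refine TensorProduct.induction_on (motive := fun u => (AlgTensor.costs (E := E) (F := F)
    u).Nonempty) u ⟨0, 0, Fin.elim0, Fin.elim0, ?_, ?_⟩ (fun x y => ?_) ?_
  · simp; rfl
  · simp
  · exact ⟨‖x‖ * ‖y‖, 1, fun _ => x, fun _ => y, by simp; rfl, by simp⟩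
  · rintro u v ⟨s, hs⟩ ⟨t, ht⟩
    exact ⟨s + t, AlgTensor.costs_add hs ht⟩

variable (E F) in
/-- The projective norm as a seminorm. -/
def AlgTensor.projSeminorm : Seminorm ℂ (AlgTensor E F) := .ofSMulLE norm
  (by
    refine le_antisymm (csInf_le (AlgTensor.costs_bddBelow _) ?_)
      (Real.sInf_nonneg (AlgTensor.costs_nonneg _))
    exact ⟨0, Fin.elim0, Fin.elim0, by simp, by simp⟩)
  (fun u v => by
    refine le_of_forall_pos_lt_add fun ε hε => ?_
    obtain ⟨s, hs, hs'⟩ := exists_lt_of_csInf_lt u.costs_nonempty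
      (lt_add_of_pos_right (sInf u.costs) (half_pos hε))
    obtain ⟨t, ht, ht'⟩ := exists_lt_of_csInf_lt v.costs_nonempty
      (lt_add_of_pos_right (sInf v.costs) (half_pos hε))
    have := csInf_le (u + v).costs_bddBelow (AlgTensor.costs_add hs ht)
    simp only [AlgTensor.norm_def]
    linarith)
  (fun c u => by
    simp only [AlgTensor.norm_def, sInf_eq_iInf']
    rw [Real.mul_iInf_of_nonneg (norm_nonneg c)]
    have := u.costs_nonempty.to_subtype
    refine le_ciInf fun s => ?_
    rw [← sInf_eq_iInf']
    exact csInf_le (c • u).costs_bddBelow (AlgTensor.costs_smul c s.2))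

instance : SeminormedAddCommGroup (AlgTensor E F) :=
  AddGroupSeminorm.toSeminormedAddCommGroup (AlgTensor.projSeminorm E F).toAddGroupSeminorm

instance : NormedSpace ℂ (AlgTensor E F) :=
  ⟨fun c u => (map_smul_eq_mul (AlgTensor.projSeminorm E F) c u).le⟩

variable (E F) in
/-- The projective tensor product: the completion of the algebraic tensor product for the
projective norm. -/
abbrev ProjTensor : Type _ := UniformSpace.Completion (AlgTensor E F)

end ProjectiveTensor

/-! ### Vector-valued Hardy spaces -/

/-- The circle, with its normalized Haar measure. A point `t` of `ℝ / ℤ` stands for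
`z = exp (2 π i t)`, so that `fourier k t = z ^ k`. -/
abbrev circleMeasure : Measure UnitAddCircle := AddCircle.haarAddCircle

section Hardy

variable (X : Type*) [NormedAddCommGroup X] [NormedSpace ℂ X]

variable {X} in
/-- The monomial `z ^ k x`, as an element of `L¹(𝕋; X)`. -/
def monomial (k : ℕ) (x : X) : Lp X 1 circleMeasure :=
  ContinuousMap.toLp 1 circleMeasure ℂ
    ⟨fun t : UnitAddCircle => fourier (k : ℤ) t • x, by fun_prop⟩

/-- The Hardy space `H̃¹(X)`: the closure in `L¹(𝕋; X)` of the `X`-valued analytic polynomials. -/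
def Hardy : Submodule ℂ (Lp X 1 circleMeasure) :=
  (Submodule.span ℂ
    (Set.range fun kx : ℕ × X => monomial kx.1 kx.2)).topologicalClosure

instance [CompleteSpace X] : CompleteSpace (Hardy X) :=
  (Submodule.isClosed_topologicalClosure _).completeSpace_coe

variable {X}

/-- The operator `h ↦ h(·) x` from `L¹(𝕋)` to `L¹(𝕋; X)`. -/
def mulVec (x : X) : Lp ℂ 1 circleMeasure →L[ℂ] Lp X 1 circleMeasure :=
  (ContinuousLinearMap.toSpanSingleton ℂ x).compLpL 1 circleMeasure

theorem coeFn_mulVec (x : X) (h : Lp ℂ 1 circleMeasure) :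
    mulVec x h =ᵐ[circleMeasure] fun t => h t • x := by
  filter_upwards [ContinuousLinearMap.coeFn_compLpL
    (ContinuousLinearMap.toSpanSingleton ℂ x) h] with t ht
  simpa [mulVec] using ht

theorem norm_mulVec_le (x : X) (h : Lp ℂ 1 circleMeasure) : ‖mulVec x h‖ ≤ ‖h‖ * ‖x‖ := by
  have := ContinuousLinearMap.norm_compLp_le (ContinuousLinearMap.toSpanSingleton ℂ x) h
  rw [ContinuousLinearMap.norm_toSpanSingleton, mul_comm] at this
  exact this

theorem coeFn_monomial (k : ℕ) (x : X) :
    monomial k x =ᵐ[circleMeasure] fun t => fourier (k : ℤ) t • x :=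
  ContinuousMap.coeFn_toLp (𝕜 := ℂ) circleMeasure _

theorem mulVec_monomial (k : ℕ) (a : ℂ) (x : X) :
    mulVec x (monomial k a) = monomial k (a • x) := by
  apply Lp.ext
  filter_upwards [coeFn_mulVec x (monomial k a), coeFn_monomial k a,
    coeFn_monomial k (a • x)] with t h1 h2 h3
  rw [h1, h2, h3, smul_eq_mul, mul_smul]

theorem mulVec_mem (x : X) (h : Hardy ℂ) : mulVec x (h : Lp ℂ 1 circleMeasure) ∈ Hardy X := by
  have hle : Submodule.span ℂ (Set.range fun kx : ℕ × ℂ => monomial kx.1 kx.2) ≤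
      (Submodule.span ℂ (Set.range fun kx : ℕ × X => monomial kx.1 kx.2)).comap
        (mulVec x).toLinearMap := by
    rw [Submodule.span_le]
    rintro _ ⟨⟨k, a⟩, rfl⟩
    exact Submodule.subset_span ⟨(k, a • x), (mulVec_monomial k a x).symm⟩
  exact map_mem_closure (mulVec x).continuous h.2 fun g hg => hle hg

/-- The bilinear map `(h, x) ↦ h(·) x` from `H¹ × X` to `H̃¹(X)`. -/
def hardyBilin : Hardy ℂ →ₗ[ℂ] X →ₗ[ℂ] Hardy X :=
  LinearMap.mk₂ ℂ (fun h x => ⟨mulVec x h, mulVec_mem x h⟩)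
    (fun h h' x => by ext1; simp)
    (fun c h x => by ext1; simp)
    (fun h x y => by
      refine Subtype.ext (Lp.ext ?_)
      filter_upwards [coeFn_mulVec (x + y) (h : Lp ℂ 1 circleMeasure), coeFn_mulVec x
        (h : Lp ℂ 1 circleMeasure), coeFn_mulVec y (h : Lp ℂ 1 circleMeasure),
        Lp.coeFn_add (mulVec x (h : Lp ℂ 1 circleMeasure)) (mulVec y h)] with t h1 h2 h3 h4
      simp only [Submodule.coe_add]
      rw [h1, h4, Pi.add_apply, h2, h3, smul_add])
    (fun c h x => by
      refine Subtype.ext (Lp.ext ?_)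
      filter_upwards [coeFn_mulVec (c • x) (h : Lp ℂ 1 circleMeasure), coeFn_mulVec x
        (h : Lp ℂ 1 circleMeasure),
        Lp.coeFn_smul c (mulVec x (h : Lp ℂ 1 circleMeasure))] with t h1 h2 h3
      simp only [Submodule.coe_smul]
      rw [h1, h3, Pi.smul_apply, h2, smul_comm])

variable (X) in
/-- The canonical linear map `H¹ ⊗ X → H̃¹(X)`, `∑ h_k ⊗ x_k ↦ ∑ h_k(·) x_k`. -/
def algInclusion : AlgTensor (Hardy ℂ) X →ₗ[ℂ] Hardy X :=
  TensorProduct.lift (hardyBilin (X := X))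

theorem algInclusion_tmul (h : Hardy ℂ) (x : X) :
    algInclusion X (AlgTensor.tmul h x) = hardyBilin h x :=
  TensorProduct.lift.tmul h x

theorem norm_algInclusion_le (u : AlgTensor (Hardy ℂ) X) : ‖algInclusion X u‖ ≤ 1 * ‖u‖ := by
  rw [one_mul, AlgTensor.norm_def]
  refine le_csInf u.costs_nonempty ?_
  rintro s ⟨m, h, x, rfl, rfl⟩
  rw [map_sum]
  refine (norm_sum_le _ _).trans (Finset.sum_le_sum fun k _ => ?_)
  rw [algInclusion_tmul]
  exact norm_mulVec_le (x k) (h k)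

variable (X) in
/-- The canonical inclusion `H¹ ⊗̂ X → H̃¹(X)`, the continuous extension to the completion of
the canonical map on `H¹ ⊗ X`. -/
def inclusion [CompleteSpace X] : ProjTensor (Hardy ℂ) X →L[ℂ] Hardy X :=
  ((algInclusion X).mkContinuous 1 norm_algInclusion_le).extend
    (UniformSpace.Completion.toComplL (𝕜 := ℂ) (E := AlgTensor (Hardy ℂ) X))

/-- The extension does agree with the canonical map on the algebraic tensor product. -/
theorem inclusion_coe [CompleteSpace X] (u : AlgTensor (Hardy ℂ) X) :
    inclusion X (u : ProjTensor (Hardy ℂ) X) = algInclusion X u :=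
  ContinuousLinearMap.extend_eq _ UniformSpace.Completion.denseRange_coe
    (UniformSpace.Completion.isUniformInducing_coe _) u

variable (X) in
/-- The `H¹`-projectivity constant `η(X)` of a complex Banach space `X`: the least `c` such that
`‖F‖_{H¹ ⊗̂ X} ≤ c ‖F‖_{H̃¹(X)}` for every `F` in `H¹ ⊗̂ X`. It is `∞` if there is no such `c`,
that is, if `X` is not `H¹`-projective. -/
def eta [CompleteSpace X] : ℝ≥0∞ :=
  sInf {c : ℝ≥0∞ | ∃ c₀ : ℝ≥0, c = c₀ ∧
    ∀ F : ProjTensor (Hardy ℂ) X, ‖F‖ ≤ c₀ * ‖inclusion X F‖}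

end Hardy

/-- The Banach-Mazur distance `d(E, F) = inf ‖T‖ ‖T⁻¹‖` over all isomorphisms `T : E → F`. -/
def banachMazur (E F : Type*) [NormedAddCommGroup E] [NormedSpace ℂ E]
    [NormedAddCommGroup F] [NormedSpace ℂ F] : ℝ≥0∞ :=
  ⨅ T : E ≃L[ℂ] F, ‖(T : E →L[ℂ] F)‖ₑ * ‖(T.symm : F →L[ℂ] E)‖ₑ

/-- The complex Banach space `ℓ_n^p`. -/
abbrev ellp (p : ℝ≥0∞) (n : ℕ) : Type := PiLp p fun _ : Fin n => ℂ

end H1Projective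

end

namespace H1Projective

/-! ### The pairing between continuous functions and integrable functions on the circle -/

/-! Lower bound: the test tensor is `u = ∑ z^(3^(k+1)) ⊗ e_k`. As a function it has coordinates of
modulus one, so its `H̃¹` norm is at most `n^(1/p)`. The form `h ⊗ x ↦ ∑ x_k ĥ(3^(k+1))` takes the
value `n` on `u`. Paley's inequality (`norm_sum_mul_pairing_le`) bounds it on elementary tensors by
`2 ‖x‖₂ ‖h‖`, hence by `2 n^(1/r - 1/p) ‖x‖_p ‖h‖`, so the same constant bounds it for the
projective norm. Comparing the two gives `n ≤ 2 η n^(1/r)`.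

Paley's inequality with constant 2 comes by duality: a Schur-type recursion (`exists_schur_step`)
builds a continuous `Φ` with `‖Φ‖ ≤ 1` that acts on `H¹` as a prescribed combination of the
coefficients of index `3^(k+1)`.

Middle inequality (`norm_le_of_equiv`): an isomorphism onto `ℓ_n^1` gives a basis of `X` in which
the coordinate functions of a tensor have `L¹` norms summing to the norm of an `ℓ_n^1`-valued
function, so expanding in that basis is a cheap representation.

Upper bound: the identity map serves for `p ≤ 2` and the discrete Fourier transform for `p ≥ 2`. -/

theorem norm_integral_mul_le (Φ : C(UnitAddCircle, ℂ)) (h : Lp ℂ 1 circleMeasure) :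
    ‖∫ t, Φ t * h t ∂circleMeasure‖ ≤ ‖Φ‖ * ‖h‖ := by
  rw [L1.norm_eq_integral_norm, ← integral_const_mul]
  refine norm_integral_le_of_norm_le ((L1.integrable_coeFn h).norm.const_mul _)
    (.of_forall fun t => ?_)
  rw [norm_mul]
  exact mul_le_mul_of_nonneg_right (Φ.norm_coe_le_norm t) (norm_nonneg _)

/-- The bilinear pairing `(Φ, h) ↦ ∫ Φ h` between continuous and integrable functions. -/
noncomputable def pairing : C(UnitAddCircle, ℂ) →L[ℂ] Lp ℂ 1 circleMeasure →L[ℂ] ℂ :=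
  have hint (Φ : C(UnitAddCircle, ℂ)) (h : Lp ℂ 1 circleMeasure) :
      Integrable (fun t => Φ t * h t) circleMeasure :=
    (L1.integrable_coeFn h).bdd_mul (c := ‖Φ‖) Φ.continuous.aestronglyMeasurable
      (.of_forall Φ.norm_coe_le_norm)
  LinearMap.mkContinuous₂
    (LinearMap.mk₂ ℂ (fun Φ h => ∫ t, Φ t * h t ∂circleMeasure)
      (fun Φ Ψ h => by
        rw [← integral_add (hint Φ h) (hint Ψ h)]
        simp only [ContinuousMap.add_apply, add_mul])
      (fun c Φ h => by
        rw [← integral_smul]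
        simp only [ContinuousMap.smul_apply, smul_eq_mul, mul_assoc])
      (fun Φ h g => by
        rw [← integral_add (hint Φ h) (hint Φ g)]
        refine integral_congr_ae ?_
        filter_upwards [Lp.coeFn_add h g] with t ht
        rw [ht, Pi.add_apply, mul_add])
      (fun c Φ h => by
        rw [← integral_smul]
        refine integral_congr_ae ?_
        filter_upwards [Lp.coeFn_smul c h] with t ht
        rw [ht, Pi.smul_apply, smul_eq_mul, smul_eq_mul, mul_left_comm])) 1
    (fun Φ h => by rw [one_mul]; exact norm_integral_mul_le Φ h)

theorem pairing_apply (Φ : C(UnitAddCircle, ℂ)) (h : Lp ℂ 1 circleMeasure) :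
    pairing Φ h = ∫ t, Φ t * h t ∂circleMeasure := rfl

theorem norm_pairing_le (Φ : C(UnitAddCircle, ℂ)) (h : Lp ℂ 1 circleMeasure) :
    ‖pairing Φ h‖ ≤ ‖Φ‖ * ‖h‖ :=
  norm_integral_mul_le Φ h

/-- There is no conjugation in the pairing, so `fourier (-m)` reads off the coefficient of index
`m`, while positive frequencies annihilate analytic functions. -/
theorem pairing_fourier_monomial (j : ℤ) (k : ℕ) (a : ℂ) :
    pairing (fourier j) (monomial k a) = if j + k = 0 then a else 0 := by
  have h1 : pairing (fourier j) (monomial k a) =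
      ∫ t : UnitAddCircle, fourier j t * (fourier (k : ℤ) t * a) ∂circleMeasure := by
    rw [pairing_apply]
    refine integral_congr_ae ?_
    filter_upwards [coeFn_monomial k a] with t ht
    rw [ht, smul_eq_mul]
  have h2 : fourierCoeff (fourier (T := 1) (k : ℤ)) (-j) =
      ∫ t : UnitAddCircle, fourier j t * fourier (k : ℤ) t ∂circleMeasure := by
    simp [fourierCoeff]
  rw [h1]
  simp only [← mul_assoc]
  rw [integral_mul_const, ← h2, fourierCoeff_fourier]
  by_cases h : j + k = 0
  · have : -j = k := by omega
    simp [h, this]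
  · have : -j ≠ k := by omega
    simp [h, this]

/-! ### The disc algebra -/

theorem fourier_mul_fourier (i j : ℤ) :
    (fourier i * fourier j : C(UnitAddCircle, ℂ)) = fourier (i + j) := by
  ext t
  simp

/-- The disc algebra, as the closed subalgebra of `C(𝕋)` generated by `z`. -/
noncomputable def discAlgebra : Subalgebra ℂ C(UnitAddCircle, ℂ) :=
  (Algebra.adjoin ℂ {fourier 1}).topologicalClosure

theorem isClosed_discAlgebra : IsClosed (discAlgebra : Set C(UnitAddCircle, ℂ)) :=
  Subalgebra.isClosed_topologicalClosure _

theorem fourier_pow (k : ℕ) : (fourier 1 ^ k : C(UnitAddCircle, ℂ)) = fourier (k : ℤ) := by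
  induction k with
  | zero => ext t; simp
  | succ k ih => rw [pow_succ, ih, fourier_mul_fourier]; push_cast; rfl

theorem fourier_mem_discAlgebra {j : ℤ} (hj : 0 ≤ j) : fourier j ∈ discAlgebra := by
  lift j to ℕ using hj
  rw [← fourier_pow]
  exact pow_mem (Subalgebra.le_topologicalClosure _
    (Algebra.subset_adjoin (Set.mem_singleton _))) j

/-- The product `z^j g h` has only positive frequencies, hence mean zero. Continuity of the pairing
reduces this to polynomials, first in `g` and then in `h`. -/
theorem pairing_eq_zero_of_mem {g : C(UnitAddCircle, ℂ)} (hg : g ∈ discAlgebra) {j : ℤ}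
    (hj : 0 < j) {h : Lp ℂ 1 circleMeasure} (hh : h ∈ Hardy ℂ) :
    pairing (fourier j * g) h = 0 := by
  have hmon : ∀ (k : ℕ) (a : ℂ), ∀ g ∈ discAlgebra,
      pairing (fourier j * g) (monomial k a) = 0 := by
    intro k a g hg
    have hcl : IsClosed {g : C(UnitAddCircle, ℂ) |
        pairing (fourier j * g) (monomial k a) = 0} :=
      isClosed_eq (by fun_prop) continuous_const
    refine closure_minimal (fun g hg => ?_) hcl hg
    rw [SetLike.mem_coe, Algebra.adjoin_singleton_eq_range_aeval] at hg
    obtain ⟨q, rfl⟩ := hg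
    change pairing _ _ = 0
    induction q using Polynomial.induction_on' with
    | add q r hq hr => simp_all [mul_add]
    | monomial i c =>
      have hne : ¬ (j + i + k = 0) := by omega
      simp [Polynomial.aeval_monomial, fourier_pow, ← Algebra.smul_def,
        fourier_mul_fourier, pairing_fourier_monomial, hne]
  have hcl : IsClosed {h : Lp ℂ 1 circleMeasure | pairing (fourier j * g) h = 0} :=
    isClosed_eq (by fun_prop) continuous_const
  refine closure_minimal (fun h hh => ?_) hcl hh
  have : Submodule.span ℂ (Set.range fun kx : ℕ × ℂ => monomial kx.1 kx.2) ≤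
      LinearMap.ker (pairing (fourier j * g)).toLinearMap := by
    rw [Submodule.span_le]
    rintro _ ⟨⟨k, a⟩, rfl⟩
    exact hmon k a g hg
  exact this hh

/-- The Neumann series converges inside the closed subalgebra, so the inverse is again analytic. -/
theorem exists_inverse_one_add {x : C(UnitAddCircle, ℂ)} (hx : x ∈ discAlgebra)
    (hx1 : ‖x‖ < 1) : ∃ g ∈ discAlgebra, g * (1 + x) = 1 := by
  have hx2 : ‖-x‖ < 1 := by rwa [norm_neg]
  refine ⟨∑' i : ℕ, (-x) ^ i, ?_, ?_⟩
  · have hs := (summable_geometric_of_norm_lt_one hx2).hasSum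
    exact isClosed_discAlgebra.mem_of_tendsto hs
      (.of_forall fun s => sum_mem fun i _ => pow_mem (neg_mem hx) i)
  · have := geom_series_mul_neg (-x) hx2
    rwa [sub_neg_eq_add] at this

/-! ### Paley's inequality for a lacunary sequence -/

/-- The difference of the squares is `(1 - |a|²)(1 - |w|²)`: Möbius maps preserve the disc. -/
theorem norm_add_le_norm_one_add_conj_mul {a w : ℂ} (ha : ‖a‖ ≤ 1) (hw : ‖w‖ ≤ 1) :
    ‖a + w‖ ≤ ‖1 + (starRingEnd ℂ) w * a‖ := by
  rw [← sq_le_sq₀ (norm_nonneg _) (norm_nonneg _)]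
  have ha' : ‖a‖ ^ 2 ≤ 1 := pow_le_one₀ (norm_nonneg _) ha
  have hw' : ‖w‖ ^ 2 ≤ 1 := pow_le_one₀ (norm_nonneg _) hw
  rw [← Complex.normSq_eq_norm_sq, Complex.normSq_apply] at *
  rw [← Complex.normSq_eq_norm_sq, Complex.normSq_apply] at *
  simp only [Complex.add_re, Complex.add_im, Complex.mul_re, Complex.mul_im, Complex.conj_re,
    Complex.conj_im, Complex.one_re, Complex.one_im]
  nlinarith [mul_nonneg (sub_nonneg.2 ha') (sub_nonneg.2 hw')]

/-- One step of the Schur algorithm. -/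
theorem exists_schur_step {Φ : C(UnitAddCircle, ℂ)} (hΦ : ‖Φ‖ ≤ 1) {M m : ℕ}
    (hM : fourier (M : ℤ) * Φ ∈ discAlgebra) (hm : 2 * M < m) {v : ℂ} (hv : ‖v‖ < 1) :
    ∃ Ψ : C(UnitAddCircle, ℂ), ‖Ψ‖ ≤ 1 ∧ fourier (m : ℤ) * Ψ ∈ discAlgebra ∧
      ∀ h ∈ Hardy ℂ, pairing Ψ h =
        v * pairing (fourier (-(m : ℤ))) h + (1 - (‖v‖ : ℂ) ^ 2) * pairing Φ h := by
  -- On the circle `u` is the conjugate of `w`, and the new function is the Möbius transform `Ψ = (Φ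
  -- + w) / (1 + u Φ)`. The hypothesis `hM` says that `Φ` has no frequency below `-M`.
  set w : C(UnitAddCircle, ℂ) := v • fourier (-(m : ℤ)) with hw
  set u : C(UnitAddCircle, ℂ) := (starRingEnd ℂ) v • fourier (m : ℤ) with hu
  have huw : u * w = ((‖v‖ : ℂ) ^ 2) • 1 := by
    rw [hu, hw, smul_mul_smul_comm, fourier_mul_fourier, Complex.conj_mul']
    congr 1
    ext t
    simp
  have hMΦ : u * Φ = ((starRingEnd ℂ) v) • (fourier ((m : ℤ) - M) * (fourier (M : ℤ) * Φ)) := by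
    rw [hu, ← mul_assoc, fourier_mul_fourier, sub_add_cancel, smul_mul_assoc]
  have hmΦ : fourier (m : ℤ) * Φ = fourier ((m : ℤ) - M) * (fourier (M : ℤ) * Φ) := by
    rw [← mul_assoc, fourier_mul_fourier, sub_add_cancel]
  have huΦ : u * Φ ∈ discAlgebra := by
    rw [hMΦ]
    exact Subalgebra.smul_mem _ (mul_mem (fourier_mem_discAlgebra (by omega)) hM) _
  have hunorm : ‖u‖ = ‖v‖ := by
    rw [hu, norm_smul, fourier_norm, mul_one, RCLike.norm_conj]
  have huΦ1 : ‖u * Φ‖ < 1 :=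
    calc ‖u * Φ‖ ≤ ‖u‖ * ‖Φ‖ := norm_mul_le _ _
      _ ≤ ‖v‖ * 1 := by rw [hunorm]; gcongr
      _ < 1 := by rwa [mul_one]
  obtain ⟨G, hG, hG1⟩ := exists_inverse_one_add huΦ huΦ1
  -- The two factors `Φ` cost `z^(-2M)`; since `m > 2M`, this term has only positive frequencies and
  -- is invisible to `H¹`.
  have hE : u * Φ ^ 2 * G = fourier ((m : ℤ) - 2 * M) *
      ((starRingEnd ℂ) v • ((fourier (M : ℤ) * Φ) ^ 2 * G)) := by
    have : (fourier (m : ℤ) : C(UnitAddCircle, ℂ)) =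
        fourier ((m : ℤ) - 2 * M) * (fourier (M : ℤ)) ^ 2 := by
      rw [sq, fourier_mul_fourier, fourier_mul_fourier]
      congr 1
      ring
    rw [hu, this]
    simp only [smul_mul_assoc, mul_smul_comm]
    congr 1
    ring
  have hE' : (starRingEnd ℂ) v • ((fourier (M : ℤ) * Φ) ^ 2 * G) ∈ discAlgebra :=
    Subalgebra.smul_mem _ (mul_mem (pow_mem hM 2) hG) _
  -- Since `u w = |v|²` is constant, `Ψ` is its first-order part `w + (1 - |v|²) Φ` up to the
  -- invisible term.
  have hΨ : (Φ + w) * G = w + (1 - (‖v‖ : ℂ) ^ 2) • Φ -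
      (1 - (‖v‖ : ℂ) ^ 2) • (u * Φ ^ 2 * G) := by
    have h1 : ∀ f : C(UnitAddCircle, ℂ), (1 - (‖v‖ : ℂ) ^ 2) • f = f - u * w * f := by
      intro f
      rw [huw]
      ext t
      simp [sub_mul]
    rw [h1, h1]
    linear_combination (Φ + w - Φ * (u * w)) * hG1
  refine ⟨(Φ + w) * G, ?_, ?_, fun h hh => ?_⟩
  · refine (ContinuousMap.norm_le _ zero_le_one).2 fun t => ?_
    have hGt : G t * (1 + u t * Φ t) = 1 := by
      simpa using congrArg (fun f : C(UnitAddCircle, ℂ) => f t) hG1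
    have hut : u t = (starRingEnd ℂ) (w t) := by
      simp only [hu, hw, ContinuousMap.smul_apply, smul_eq_mul, map_mul, fourier_neg,
        Complex.conj_conj]
    have hwt : ‖w t‖ ≤ 1 := by
      rw [← RCLike.norm_conj, ← hut]
      exact (u.norm_coe_le_norm t).trans (hunorm.le.trans hv.le)
    have key := norm_add_le_norm_one_add_conj_mul ((Φ.norm_coe_le_norm t).trans hΦ) hwt
    rw [← hut] at key
    rw [ContinuousMap.mul_apply, ContinuousMap.add_apply, norm_mul]
    calc ‖Φ t + w t‖ * ‖G t‖ ≤ ‖1 + u t * Φ t‖ * ‖G t‖ := by gcongr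
      _ = 1 := by rw [← norm_mul, mul_comm, hGt, norm_one]
  · rw [← mul_assoc, mul_add]
    refine mul_mem (add_mem ?_ ?_) hG
    · rw [hmΦ]
      exact mul_mem (fourier_mem_discAlgebra (by omega)) hM
    · rw [hw, mul_smul_comm, fourier_mul_fourier]
      exact Subalgebra.smul_mem _ (fourier_mem_discAlgebra (by omega)) _
  · have hz := pairing_eq_zero_of_mem hE' (j := (m : ℤ) - 2 * M) (by omega) hh
    rw [hΨ, hE, hw]
    simp [hz]

/-- Each Schur step adds one coefficient and multiplies the earlier ones by `1 - |c n|²`, so the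
induction starts from coefficients divided by that factor. The degree bound `3^n` is carried along
because the next step needs `3^(n+1) > 2 · 3^n`. -/
theorem exists_bounded_interpolation (n : ℕ) (c : ℕ → ℂ)
    (hc : ∑ k ∈ Finset.range n, ‖c k‖ ^ 2 < 1 / 2) :
    ∃ Φ : C(UnitAddCircle, ℂ), ‖Φ‖ ≤ 1 ∧ fourier ((3 ^ n : ℕ) : ℤ) * Φ ∈ discAlgebra ∧
      ∀ h ∈ Hardy ℂ, pairing Φ h =
        ∑ k ∈ Finset.range n, c k * pairing (fourier (-((3 ^ (k + 1) : ℕ) : ℤ))) h := by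
  induction n generalizing c with
  | zero => exact ⟨0, by simp, by simp, by simp⟩
  | succ n ih =>
    rw [Finset.sum_range_succ] at hc
    set s := ∑ k ∈ Finset.range n, ‖c k‖ ^ 2
    have hs : 0 ≤ s := Finset.sum_nonneg fun _ _ => by positivity
    have hv2 : ‖c n‖ ^ 2 < 1 / 2 := by linarith
    have hv : ‖c n‖ < 1 := by nlinarith [norm_nonneg (c n)]
    set d : ℝ := 1 - ‖c n‖ ^ 2 with hd
    have hd0 : 0 < d := by linarith
    have hdc : (1 - (‖c n‖ : ℂ) ^ 2) = (d : ℂ) := by rw [hd]; push_cast; rfl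
    -- With `a = |c n|²`, the bound `1/2` is preserved because `s < 1/2 - a ≤ (1 - a)² / 2`.
    obtain ⟨Φ, hΦ, hM, hp⟩ := ih (fun k => c k / d) (by
      simp only [norm_div, div_pow, ← Finset.sum_div]
      rw [Complex.norm_real, Real.norm_of_nonneg hd0.le, div_lt_iff₀ (by positivity)]
      nlinarith [sq_nonneg (‖c n‖ ^ 2)])
    obtain ⟨Ψ, hΨ, hm, hq⟩ := exists_schur_step hΦ hM (m := 3 ^ (n + 1))
      (by have := Nat.pow_pos (n := n) (show 0 < 3 by norm_num); omega) hv
    refine ⟨Ψ, hΨ, hm, fun h hh => ?_⟩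
    rw [hq h hh, hp h hh, hdc, Finset.sum_range_succ, add_comm, Finset.mul_sum]
    congr 1
    refine Finset.sum_congr rfl fun k _ => ?_
    have : (d : ℂ) ≠ 0 := by exact_mod_cast hd0.ne'
    field_simp

/-- **Paley's inequality**, in dual form, for the lacunary sequence `3 ^ (k + 1)`. -/
theorem norm_sum_mul_pairing_le (n : ℕ) (x : ℕ → ℂ) {h : Lp ℂ 1 circleMeasure}
    (hh : h ∈ Hardy ℂ) :
    ‖∑ k ∈ Finset.range n, x k * pairing (fourier (-((3 ^ (k + 1) : ℕ) : ℤ))) h‖ ≤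
      2 * √(∑ k ∈ Finset.range n, ‖x k‖ ^ 2) * ‖h‖ := by
  set s := ∑ k ∈ Finset.range n, ‖x k‖ ^ 2 with hs
  have hs0 : 0 ≤ s := Finset.sum_nonneg fun _ _ => by positivity
  rcases hs0.eq_or_lt with h0 | hpos
  · have hx : ∀ k ∈ Finset.range n, x k = 0 := fun k hk => by
      have := (Finset.sum_eq_zero_iff_of_nonneg (fun _ _ => by positivity)).1 h0.symm k hk
      simpa using this
    rw [Finset.sum_eq_zero fun k hk => by rw [hx k hk, zero_mul], ← h0]
    simp
  -- Dividing by `r` makes the sum of squares `1/4`, strictly below the threshold `1/2`.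
  set r : ℝ := 2 * √s with hr
  have hr0 : 0 < r := by positivity
  have hr2 : r ^ 2 = 4 * s := by rw [hr, mul_pow, Real.sq_sqrt hs0]; norm_num
  obtain ⟨Φ, hΦ, -, hp⟩ := exists_bounded_interpolation n (fun k => x k / r) (by
    simp only [norm_div, div_pow, ← Finset.sum_div]
    rw [Complex.norm_real, Real.norm_of_nonneg hr0.le, div_lt_iff₀ (by positivity), hr2]
    linarith)
  have hsum : ∑ k ∈ Finset.range n, x k * pairing (fourier (-((3 ^ (k + 1) : ℕ) : ℤ))) h =
      r * pairing Φ h := by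
    rw [hp h hh, Finset.mul_sum]
    refine Finset.sum_congr rfl fun k _ => ?_
    have : (r : ℂ) ≠ 0 := by exact_mod_cast hr0.ne'
    field_simp
  rw [hsum, norm_mul, Complex.norm_real, Real.norm_of_nonneg hr0.le]
  gcongr
  exact (norm_pairing_le Φ h).trans (mul_le_of_le_one_left (norm_nonneg _) hΦ)

/-! ### Comparison of the `ℓ^p` norms -/

section EllpNorm

variable {p : ℝ≥0∞} [Fact (1 ≤ p)] {n : ℕ}

theorem toReal_pos_of_ne_top (hp : p ≠ ∞) : 0 < p.toReal :=
  ENNReal.toReal_pos (zero_lt_one.trans_le Fact.out).ne' hp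

theorem ellp_norm_rpow (hp : p ≠ ∞) (x : ellp p n) :
    ‖x‖ ^ p.toReal = ∑ i, ‖x i‖ ^ p.toReal := by
  have h0 := toReal_pos_of_ne_top hp
  rw [PiLp.norm_eq_sum h0, ← Real.rpow_mul (Finset.sum_nonneg fun _ _ => by positivity),
    one_div_mul_cancel h0.ne', Real.rpow_one]

/-- For `p = ∞`, `p.toReal = 0` and division by zero make `1 / p.toReal` equal to `0`, the correct
exponent here and in the later comparisons. -/
theorem ellp_norm_le_of_apply_le {x : ellp p n} {C : ℝ} (hC : 0 ≤ C) (hx : ∀ i, ‖x i‖ ≤ C) :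
    ‖x‖ ≤ (n : ℝ) ^ (1 / p.toReal) * C := by
  rcases eq_or_ne p ∞ with rfl | hp
  · rw [PiLp.norm_eq_ciSup]
    simpa using Real.iSup_le hx hC
  · have h0 := toReal_pos_of_ne_top hp
    rw [← Real.rpow_le_rpow_iff (norm_nonneg _) (by positivity) h0, ellp_norm_rpow hp,
      Real.mul_rpow (by positivity) hC, ← Real.rpow_mul (by positivity),
      one_div_mul_cancel h0.ne', Real.rpow_one]
    calc ∑ i, ‖x i‖ ^ p.toReal ≤ ∑ _i : Fin n, C ^ p.toReal := by
          gcongr with i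
          exact hx i
      _ = n * C ^ p.toReal := by simp

/-- For finite `p` this is the power mean inequality with exponent `p / q`. The cases `q = 1` and `q
= 2` are used. -/
theorem sum_rpow_norm_le {q : ℝ} (hq : 0 < q) (hqp : ENNReal.ofReal q ≤ p) (x : ellp p n) :
    ∑ i, ‖x i‖ ^ q ≤ (n : ℝ) ^ (1 - q / p.toReal) * ‖x‖ ^ q := by
  rcases eq_or_ne p ∞ with rfl | hp
  · calc ∑ i, ‖x i‖ ^ q ≤ ∑ _i : Fin n, ‖x‖ ^ q := by
          gcongr with i
          exact PiLp.norm_apply_le x i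
      _ = _ := by simp
  · have h0 := toReal_pos_of_ne_top hp
    have hqp' : q ≤ p.toReal := by rwa [ENNReal.ofReal_le_iff_le_toReal hp] at hqp
    have key := Real.rpow_sum_le_const_mul_sum_rpow Finset.univ (fun i => ‖x i‖ ^ q)
      (p := p.toReal / q) ((one_le_div hq).2 hqp')
    have habs : ∀ i, |‖x i‖ ^ q| = ‖x i‖ ^ q := fun i => abs_of_nonneg (by positivity)
    simp only [habs, ← Real.rpow_mul (norm_nonneg _), mul_div_cancel₀ _ hq.ne',
      Finset.card_univ, Fintype.card_fin] at key
    rw [← ellp_norm_rpow hp] at key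
    rw [← Real.rpow_le_rpow_iff (Finset.sum_nonneg fun _ _ => by positivity) (by positivity)
      (show 0 < p.toReal / q by positivity)]
    refine key.trans_eq ?_
    rw [Real.mul_rpow (by positivity) (by positivity), ← Real.rpow_mul (by positivity),
      ← Real.rpow_mul (norm_nonneg _), mul_div_cancel₀ _ hq.ne']
    congr 2
    field_simp

theorem sum_norm_le (x : ellp p n) : ∑ i, ‖x i‖ ≤ (n : ℝ) ^ (1 - 1 / p.toReal) * ‖x‖ := by
  simpa using sum_rpow_norm_le zero_lt_one (by simpa using Fact.out) x

theorem ellp_norm_le_sum_norm (x : ellp p n) : ‖x‖ ≤ ∑ i, ‖x i‖ := by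
  have hx : x = ∑ i, (PiLp.single p i (x i) : ellp p n) := by
    ext j
    simp
  calc ‖x‖ = ‖∑ i, (PiLp.single p i (x i) : ellp p n)‖ := by rw [← hx]
    _ ≤ ∑ i, ‖(PiLp.single p i (x i) : ellp p n)‖ := norm_sum_le _ _
    _ = ∑ i, ‖x i‖ := by simp

theorem sum_sq_norm_le_of_two_le (hp : 2 ≤ p) (x : ellp p n) :
    √(∑ i, ‖x i‖ ^ 2) ≤ (n : ℝ) ^ (1 / 2 - 1 / p.toReal) * ‖x‖ := by
  have key := sum_rpow_norm_le (q := 2) (by norm_num) (by simpa using hp) x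
  simp only [Real.rpow_two] at key
  refine Real.sqrt_le_iff.2 ⟨by positivity, key.trans_eq ?_⟩
  rw [mul_pow, ← Real.rpow_mul_natCast (by positivity)]
  congr 2
  push_cast
  ring

/-- Write `|x_i|² = |x_i|^p |x_i|^(2-p)` and bound the second factor by `‖x‖^(2-p)`. -/
theorem sum_sq_norm_le_of_le_two (hp : p ≤ 2) (x : ellp p n) :
    √(∑ i, ‖x i‖ ^ 2) ≤ ‖x‖ := by
  have hpt : p ≠ ∞ := (hp.trans_lt (by simp)).ne
  have hp2 : p.toReal ≤ 2 := by simpa using ENNReal.toReal_mono (by simp) hp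
  have h0 := toReal_pos_of_ne_top hpt
  have h2 : 0 ≤ 2 - p.toReal := sub_nonneg.2 hp2
  refine Real.sqrt_le_iff.2 ⟨norm_nonneg _, ?_⟩
  have hsplit : ∀ a : ℝ, 0 ≤ a → a ^ 2 = a ^ p.toReal * a ^ (2 - p.toReal) := fun a ha => by
    rw [← Real.rpow_add_of_nonneg ha h0.le (by linarith), add_sub_cancel, Real.rpow_two]
  calc ∑ i, ‖x i‖ ^ 2 = ∑ i, ‖x i‖ ^ p.toReal * ‖x i‖ ^ (2 - p.toReal) :=
        Finset.sum_congr rfl fun i _ => hsplit _ (norm_nonneg _)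
    _ ≤ ∑ i, ‖x i‖ ^ p.toReal * ‖x‖ ^ (2 - p.toReal) := by
        gcongr with i
        exact PiLp.norm_apply_le x i
    _ = ‖x‖ ^ 2 := by
        rw [← Finset.sum_mul, ← ellp_norm_rpow hpt, ← hsplit _ (norm_nonneg _)]

theorem sum_sq_norm_le (x : ellp p n) :
    √(∑ i, ‖x i‖ ^ 2) ≤ (n : ℝ) ^ (1 / (min 2 p).toReal - 1 / p.toReal) * ‖x‖ := by
  rcases le_total p 2 with hp | hp
  · simpa [min_eq_right hp] using sum_sq_norm_le_of_le_two hp x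
  · simpa [min_eq_left hp] using sum_sq_norm_le_of_two_le hp x

end EllpNorm

/-! ### The Banach–Mazur distance from `ℓ_n^p` to `ℓ_n^1` -/

theorem banachMazur_le {E F : Type*} [NormedAddCommGroup E] [NormedSpace ℂ E]
    [NormedAddCommGroup F] [NormedSpace ℂ F] (T : E ≃L[ℂ] F) {a b : ℝ} (ha : 0 ≤ a)
    (hb : 0 ≤ b) (hT : ∀ x, ‖T x‖ ≤ a * ‖x‖) (hS : ∀ y, ‖T.symm y‖ ≤ b * ‖y‖) :
    banachMazur E F ≤ ENNReal.ofReal (a * b) := by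
  refine (iInf_le _ T).trans ?_
  rw [ENNReal.ofReal_mul ha, ← ofReal_norm, ← ofReal_norm]
  gcongr
  · exact ContinuousLinearMap.opNorm_le_bound _ ha hT
  · exact ContinuousLinearMap.opNorm_le_bound _ hb hS

open ZMod in
/-- **Parseval's identity** for the discrete Fourier transform. -/
theorem sum_sq_norm_dft {n : ℕ} [NeZero n] (f : ZMod n → ℂ) :
    ∑ k, ‖dft f k‖ ^ 2 = n * ∑ j, ‖f j‖ ^ 2 := by
  have hconj : ∀ k, (starRingEnd ℂ) (dft f k) = dft (fun j => (starRingEnd ℂ) (f j)) (-k) := by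
    intro k
    simp only [dft_apply, map_sum, smul_eq_mul, map_mul, mul_neg, neg_neg]
    refine Finset.sum_congr rfl fun j _ => ?_
    rw [← AddChar.map_neg_eq_conj, neg_neg]
  -- Fourier inversion for the conjugated function: applying the transform twice gives `n` times the
  -- reflection.
  have hinv : ∀ j, ∑ k, stdAddChar (-(j * k)) * (starRingEnd ℂ) (dft f k) =
      n * (starRingEnd ℂ) (f j) := by
    intro j
    have h := congrFun (dft_comp_neg (dft fun j => (starRingEnd ℂ) (f j))) j
    rw [dft_dft] at h
    simp only [neg_neg, smul_eq_mul] at h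
    rw [← h, dft_apply]
    refine Finset.sum_congr rfl fun k _ => ?_
    rw [hconj, smul_eq_mul, mul_comm j k]
  have hmul : ∀ (k : ZMod n) (c : ℂ),
      dft f k * c = ∑ j, f j * (stdAddChar (-(j * k)) * c) := by
    intro k c
    rw [dft_apply, Finset.sum_mul]
    refine Finset.sum_congr rfl fun j _ => ?_
    rw [smul_eq_mul]
    ring
  have hC : ((∑ k, ‖dft f k‖ ^ 2 : ℝ) : ℂ) = ((n * ∑ j, ‖f j‖ ^ 2 : ℝ) : ℂ) := by
    push_cast
    simp only [← Complex.mul_conj', Finset.mul_sum]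
    calc ∑ k, dft f k * (starRingEnd ℂ) (dft f k)
        = ∑ k, ∑ j, f j * (stdAddChar (-(j * k)) * (starRingEnd ℂ) (dft f k)) := by
          exact Finset.sum_congr rfl fun k _ => hmul _ _
      _ = ∑ j, f j * ∑ k, stdAddChar (-(j * k)) * (starRingEnd ℂ) (dft f k) := by
          rw [Finset.sum_comm]
          simp only [Finset.mul_sum]
      _ = ∑ j, n * (f j * (starRingEnd ℂ) (f j)) := by
          refine Finset.sum_congr rfl fun j _ => ?_
          rw [hinv]
          ring
  exact_mod_cast hC

/-- The discrete Fourier transform, as an isomorphism from `ℓ_n^p` onto `ℓ_n^1`. -/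
noncomputable def dftEquiv (p : ℝ≥0∞) [Fact (1 ≤ p)] (n : ℕ) [NeZero n] :
    ellp p n ≃L[ℂ] ellp 1 n :=
  (WithLp.linearEquiv p ℂ (Fin n → ℂ) ≪≫ₗ
    LinearEquiv.funCongrLeft ℂ ℂ (ZMod.finEquiv n).symm.toEquiv ≪≫ₗ ZMod.dft ≪≫ₗ
    LinearEquiv.funCongrLeft ℂ ℂ (ZMod.finEquiv n).toEquiv ≪≫ₗ
    (WithLp.linearEquiv 1 ℂ (Fin n → ℂ)).symm).toContinuousLinearEquiv

section

variable {p : ℝ≥0∞} [Fact (1 ≤ p)] {n : ℕ} [NeZero n]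

theorem dftEquiv_apply (x : ellp p n) (i : Fin n) :
    dftEquiv p n x i =
      ZMod.dft (fun j => x ((ZMod.finEquiv n).symm j)) (ZMod.finEquiv n i) := rfl

theorem dftEquiv_symm_apply (y : ellp 1 n) (i : Fin n) :
    (dftEquiv p n).symm y i =
      ZMod.dft.symm (fun j => y ((ZMod.finEquiv n).symm j)) (ZMod.finEquiv n i) := rfl

theorem sum_sq_norm_dftEquiv (x : ellp p n) :
    ∑ i, ‖dftEquiv p n x i‖ ^ 2 = n * ∑ i, ‖x i‖ ^ 2 := by
  simp only [dftEquiv_apply]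
  refine (Equiv.sum_comp (ZMod.finEquiv n).toEquiv
    (fun k => ‖ZMod.dft (fun j => x ((ZMod.finEquiv n).symm j)) k‖ ^ 2)).trans ?_
  rw [sum_sq_norm_dft]
  congr 1
  exact Equiv.sum_comp (ZMod.finEquiv n).symm.toEquiv (fun i => ‖x i‖ ^ 2)

/-- All matrix entries of the inverse transform have modulus `1/n`. -/
theorem norm_dftEquiv_symm_apply_le (y : ellp 1 n) (i : Fin n) :
    ‖(dftEquiv p n).symm y i‖ ≤ (n : ℝ)⁻¹ * ‖y‖ := by
  rw [dftEquiv_symm_apply, ZMod.invDFT_apply, norm_smul, norm_inv, Complex.norm_natCast]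
  gcongr
  refine (norm_sum_le _ _).trans_eq ?_
  simp only [norm_smul, ZMod.stdAddChar_apply, Circle.norm_coe, one_mul]
  rw [PiLp.norm_eq_of_L1]
  exact Equiv.sum_comp (ZMod.finEquiv n).symm.toEquiv (fun i => ‖y i‖)

/-- Cauchy–Schwarz and Parseval each contribute `n^(1/2)`, and passing from `ℓ²` to `ℓ^p`
contributes `n^(1/2 - 1/p)`. -/
theorem norm_dftEquiv_le (hp : 2 ≤ p) (x : ellp p n) :
    ‖dftEquiv p n x‖ ≤ (n : ℝ) ^ (3 / 2 - 1 / p.toReal) * ‖x‖ := by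
  have hn : (0 : ℝ) < n := by exact_mod_cast NeZero.pos n
  calc ‖dftEquiv p n x‖ = ∑ i, ‖dftEquiv p n x i‖ := PiLp.norm_eq_of_L1 _
    _ ≤ √n * √(∑ i, ‖dftEquiv p n x i‖ ^ 2) := by
        rw [← Real.sqrt_mul hn.le]
        refine Real.le_sqrt_of_sq_le ?_
        simpa using sq_sum_le_card_mul_sum_sq (s := Finset.univ)
          (f := fun i => ‖dftEquiv p n x i‖)
    _ = n * √(∑ i, ‖x i‖ ^ 2) := by
        rw [sum_sq_norm_dftEquiv, Real.sqrt_mul hn.le, ← mul_assoc, Real.mul_self_sqrt hn.le]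
    _ ≤ n * ((n : ℝ) ^ (1 / 2 - 1 / p.toReal) * ‖x‖) := by
        gcongr
        exact sum_sq_norm_le_of_two_le hp x
    _ = (n : ℝ) ^ (3 / 2 - 1 / p.toReal) * ‖x‖ := by
        rw [← mul_assoc, ← Real.rpow_one_add' hn.le]
        · congr 2
          ring
        · have : 1 / p.toReal ≤ 1 := by
            rcases eq_or_ne p ∞ with rfl | hpt
            · simp
            · rw [one_div]
              exact inv_le_one_of_one_le₀ (by simpa using ENNReal.toReal_mono hpt (Fact.out : 1 ≤ p))
          linarith

/-- The inverse transform has norm at most `n^(1/p - 1)` from `ℓ_n^1` to `ℓ_n^p`, so `p` cancels in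
the product. -/
theorem banachMazur_ellp_le_sqrt (hp : 2 ≤ p) :
    banachMazur (ellp p n) (ellp 1 n) ≤ ENNReal.ofReal ((n : ℝ) ^ (1 / 2 : ℝ)) := by
  have hn : (0 : ℝ) < n := by exact_mod_cast NeZero.pos n
  refine (banachMazur_le (dftEquiv p n) (b := (n : ℝ) ^ (1 / p.toReal) * (n : ℝ)⁻¹)
    (by positivity) (by positivity) (norm_dftEquiv_le hp) fun y => ?_).trans_eq ?_
  · rw [mul_assoc]
    exact ellp_norm_le_of_apply_le (by positivity) (norm_dftEquiv_symm_apply_le y)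
  · rw [← Real.rpow_neg_one, ← Real.rpow_add hn, ← Real.rpow_add hn]
    congr 2
    ring

end

theorem banachMazur_ellp_le_rpow (p : ℝ≥0∞) [Fact (1 ≤ p)] (n : ℕ) :
    banachMazur (ellp p n) (ellp 1 n) ≤
      ENNReal.ofReal ((n : ℝ) ^ (1 - 1 / p.toReal)) := by
  let T : ellp p n ≃L[ℂ] ellp 1 n := (WithLp.linearEquiv p ℂ (Fin n → ℂ) ≪≫ₗ
    (WithLp.linearEquiv 1 ℂ (Fin n → ℂ)).symm).toContinuousLinearEquiv
  refine (banachMazur_le T (a := (n : ℝ) ^ (1 - 1 / p.toReal)) (b := 1) (by positivity)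
    zero_le_one (fun x => ?_) fun y => ?_).trans_eq (by rw [mul_one])
  · rw [PiLp.norm_eq_of_L1]
    exact sum_norm_le x
  · rw [one_mul, PiLp.norm_eq_of_L1]
    exact ellp_norm_le_sum_norm (T.symm y)

theorem banachMazur_ellp_le (p : ℝ≥0∞) [Fact (1 ≤ p)] {n : ℕ} (hn : 1 ≤ n) :
    banachMazur (ellp p n) (ellp 1 n) ≤
      ENNReal.ofReal ((n : ℝ) ^ (1 - 1 / (min 2 p).toReal)) := by
  rcases le_total p 2 with hp | hp
  · simpa only [min_eq_right hp] using banachMazur_ellp_le_rpow p n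
  · have : NeZero n := ⟨by omega⟩
    refine (banachMazur_ellp_le_sqrt hp).trans_eq ?_
    rw [min_eq_left hp, ENNReal.toReal_ofNat]
    norm_num

/-! ### Bounds for the projectivity constant -/

section

variable {X : Type*} [NormedAddCommGroup X] [NormedSpace ℂ X]

theorem AlgTensor.induction {E F : Type*} [NormedAddCommGroup E] [NormedSpace ℂ E]
    [NormedAddCommGroup F] [NormedSpace ℂ F] {P : AlgTensor E F → Prop} (u : AlgTensor E F)
    (zero : P 0) (tmul : ∀ x y, P (AlgTensor.tmul x y)) (add : ∀ u v, P u → P v → P (u + v)) :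
    P u :=
  TensorProduct.induction_on (motive := P) u zero tmul add

theorem AlgTensor.norm_sum_tmul_le {E F : Type*} [NormedAddCommGroup E] [NormedSpace ℂ E]
    [NormedAddCommGroup F] [NormedSpace ℂ F] {n : ℕ} (x : Fin n → E) (y : Fin n → F) :
    ‖∑ k, AlgTensor.tmul (x k) (y k)‖ ≤ ∑ k, ‖x k‖ * ‖y k‖ :=
  csInf_le (AlgTensor.costs_bddBelow _) ⟨n, x, y, rfl, rfl⟩

theorem ProjTensor.norm_coe {E F : Type*} [NormedAddCommGroup E] [NormedSpace ℂ E]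
    [NormedAddCommGroup F] [NormedSpace ℂ F] (u : AlgTensor E F) :
    ‖(u : ProjTensor E F)‖ = ‖u‖ :=
  UniformSpace.Completion.norm_coe u

theorem AlgTensor.tmul_sum {E F ι : Type*} [NormedAddCommGroup E] [NormedSpace ℂ E]
    [NormedAddCommGroup F] [NormedSpace ℂ F] (s : Finset ι) (x : E) (y : ι → F) :
    AlgTensor.tmul x (∑ k ∈ s, y k) = ∑ k ∈ s, AlgTensor.tmul x (y k) :=
  TensorProduct.tmul_sum x s y

/-- The slice map `∑ h_k ⊗ x_k ↦ ∑ φ(x_k) h_k`. -/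
noncomputable def slice (φ : X →L[ℂ] ℂ) : AlgTensor (Hardy ℂ) X →ₗ[ℂ] Hardy ℂ :=
  TensorProduct.lift ((LinearMap.lsmul ℂ (Hardy ℂ)).flip.compl₂ φ.toLinearMap)

theorem slice_tmul (φ : X →L[ℂ] ℂ) (h : Hardy ℂ) (x : X) :
    slice φ (AlgTensor.tmul h x) = φ x • h :=
  TensorProduct.lift.tmul h x

/-- Slices can be computed pointwise from the function represented by the tensor, so their `L¹`
norms are controlled by its `H̃¹` norm. -/
theorem slice_eq_compLp (φ : X →L[ℂ] ℂ) (u : AlgTensor (Hardy ℂ) X) :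
    (slice φ u : Lp ℂ 1 circleMeasure) =
      φ.compLpL 1 circleMeasure (algInclusion X u : Lp X 1 circleMeasure) := by
  induction u using AlgTensor.induction with
  | zero => simp
  | add u v hu hv => simp [hu, hv]
  | tmul h x =>
    rw [slice_tmul, algInclusion_tmul]
    refine Lp.ext ?_
    filter_upwards [ContinuousLinearMap.coeFn_compLpL φ (mulVec x (h : Lp ℂ 1 circleMeasure)),
      coeFn_mulVec x (h : Lp ℂ 1 circleMeasure),
      Lp.coeFn_smul (φ x) (h : Lp ℂ 1 circleMeasure)] with t h1 h2 h3
    refine h3.trans (Eq.trans ?_ h1.symm)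
    rw [h2, Pi.smul_apply, smul_eq_mul, map_smul, smul_eq_mul, mul_comm]

/-- Expand `u` in the basis `e i = T⁻¹(δ_i)`, where `‖e i‖ ≤ ‖T⁻¹‖`. The coefficients are slices,
and their norms sum to `∫ ‖T g(t)‖₁ dt`, where `g` is the function of `u`; this additivity is
special to `ℓ¹`. -/
theorem norm_le_of_equiv {n : ℕ} (T : X ≃L[ℂ] ellp 1 n) (u : AlgTensor (Hardy ℂ) X) :
    ‖u‖ ≤ ‖(T : X →L[ℂ] ellp 1 n)‖ * ‖(T.symm : ellp 1 n →L[ℂ] X)‖ * ‖algInclusion X u‖ := by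
  set φ : Fin n → X →L[ℂ] ℂ := fun i =>
    (PiLp.proj 1 (fun _ : Fin n => ℂ) i : ellp 1 n →L[ℂ] ℂ).comp (T : X →L[ℂ] ellp 1 n) with hφ
  set e : Fin n → X := fun i => T.symm (PiLp.single 1 i 1) with he
  have hx : ∀ x : X, x = ∑ i, φ i x • e i := by
    intro x
    apply T.injective
    ext j
    simp [hφ, he, Pi.single_apply]
  have hu : u = ∑ i, AlgTensor.tmul (slice (φ i) u) (e i) := by
    induction u using AlgTensor.induction with
    | zero =>
      refine (Finset.sum_eq_zero fun i _ => ?_).symm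
      rw [map_zero]
      exact TensorProduct.zero_tmul _ _
    | add u v hu hv =>
      conv_lhs => rw [hu, hv]
      rw [← Finset.sum_add_distrib]
      refine Finset.sum_congr rfl fun i _ => ?_
      rw [map_add]
      exact (TensorProduct.add_tmul _ _ _).symm
    | tmul h x =>
      conv_lhs => rw [hx x, AlgTensor.tmul_sum]
      refine Finset.sum_congr rfl fun i _ => ?_
      rw [slice_tmul]
      exact (TensorProduct.smul_tmul _ _ _).symm
  have he_norm : ∀ i, ‖e i‖ ≤ ‖(T.symm : ellp 1 n →L[ℂ] X)‖ := fun i => by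
    simpa [he] using (T.symm : ellp 1 n →L[ℂ] X).le_opNorm (PiLp.single 1 i 1)
  set g : Lp X 1 circleMeasure := (algInclusion X u : Lp X 1 circleMeasure) with hg
  have hgi : Integrable g circleMeasure := L1.integrable_coeFn g
  have hslice : ∀ i, ‖slice (φ i) u‖ = ∫ t, ‖φ i (g t)‖ ∂circleMeasure := fun i => by
    rw [Submodule.coe_norm, slice_eq_compLp, L1.norm_eq_integral_norm]
    refine integral_congr_ae ?_
    filter_upwards [ContinuousLinearMap.coeFn_compLpL (φ i) g] with t ht
    rw [ht]
  have hsum : ∑ i, ‖slice (φ i) u‖ ≤ ‖(T : X →L[ℂ] ellp 1 n)‖ * ‖algInclusion X u‖ := by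
    simp only [hslice]
    rw [← integral_finsetSum _ fun i _ => ((φ i).integrable_comp hgi).norm,
      Submodule.coe_norm, L1.norm_eq_integral_norm, ← integral_const_mul]
    refine integral_mono (integrable_finsetSum _ fun i _ => ((φ i).integrable_comp hgi).norm)
      (hgi.norm.const_mul _) fun t => ?_
    have := (T : X →L[ℂ] ellp 1 n).le_opNorm (g t)
    rwa [PiLp.norm_eq_of_L1] at this
  calc ‖u‖ = ‖∑ i, AlgTensor.tmul (slice (φ i) u) (e i)‖ := by rw [← hu]
    _ ≤ ∑ i, ‖slice (φ i) u‖ * ‖e i‖ := AlgTensor.norm_sum_tmul_le _ _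
    _ ≤ ∑ i, ‖slice (φ i) u‖ * ‖(T.symm : ellp 1 n →L[ℂ] X)‖ := by
        gcongr with i
        exact he_norm i
    _ ≤ ‖(T : X →L[ℂ] ellp 1 n)‖ * ‖algInclusion X u‖ * ‖(T.symm : ellp 1 n →L[ℂ] X)‖ := by
        rw [← Finset.sum_mul]
        gcongr
    _ = _ := by ring

theorem eta_le_banachMazur [CompleteSpace X] (n : ℕ) : eta X ≤ banachMazur X (ellp 1 n) := by
  refine le_iInf fun T => sInf_le ⟨‖(T : X →L[ℂ] ellp 1 n)‖₊ *
    ‖(T.symm : ellp 1 n →L[ℂ] X)‖₊, by push_cast; rfl, fun F => ?_⟩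
  induction F using UniformSpace.Completion.induction_on with
  | hp => exact isClosed_le continuous_norm (by fun_prop)
  | ih u =>
    rw [inclusion_coe, ProjTensor.norm_coe]
    simpa using norm_le_of_equiv T u

end

section LowerBound

variable {p : ℝ≥0∞} [Fact (1 ≤ p)] {n : ℕ}

theorem norm_sum_apply_mul_pairing_le (h : Hardy ℂ) (x : ellp p n) :
    ‖∑ k : Fin n, x k * pairing (fourier (-((3 ^ ((k : ℕ) + 1) : ℕ) : ℤ))) h‖ ≤
      2 * (n : ℝ) ^ (1 / (min 2 p).toReal - 1 / p.toReal) * (‖h‖ * ‖x‖) := by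
  set y : ℕ → ℂ := fun k => if hk : k < n then x ⟨k, hk⟩ else 0 with hy
  have hyx : ∀ k : Fin n, y k = x k := fun k => by simp [hy]
  have key := norm_sum_mul_pairing_le n y h.2
  rw [Finset.sum_range, Finset.sum_range] at key
  simp only [hyx] at key
  calc _ ≤ _ := key
    _ ≤ 2 * ((n : ℝ) ^ (1 / (min 2 p).toReal - 1 / p.toReal) * ‖x‖) * ‖h‖ := by
        rw [Submodule.coe_norm]
        gcongr
        exact sum_sq_norm_le x
    _ = _ := by ring

variable (p n) in
/-- The linear form `h ⊗ x ↦ ∑ x_k ĥ(3 ^ (k + 1))`. -/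
noncomputable def paleyForm : AlgTensor (Hardy ℂ) (ellp p n) →ₗ[ℂ] ℂ :=
  TensorProduct.lift (LinearMap.mk₂ ℂ
    (fun (h : Hardy ℂ) (x : ellp p n) =>
      ∑ k : Fin n, x k * pairing (fourier (-((3 ^ ((k : ℕ) + 1) : ℕ) : ℤ))) h)
    (fun h h' x => by simp [mul_add, Finset.sum_add_distrib])
    (fun c h x => by simp [Finset.mul_sum, mul_left_comm])
    (fun h x y => by simp [add_mul, Finset.sum_add_distrib])
    (fun c h x => by simp [Finset.mul_sum, mul_assoc]))

theorem paleyForm_tmul (h : Hardy ℂ) (x : ellp p n) :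
    paleyForm p n (AlgTensor.tmul h x) =
      ∑ k : Fin n, x k * pairing (fourier (-((3 ^ ((k : ℕ) + 1) : ℕ) : ℤ))) h :=
  TensorProduct.lift.tmul h x

theorem norm_paleyForm_le (hn : 1 ≤ n) (u : AlgTensor (Hardy ℂ) (ellp p n)) :
    ‖paleyForm p n u‖ ≤
      2 * (n : ℝ) ^ (1 / (min 2 p).toReal - 1 / p.toReal) * ‖u‖ := by
  have hn' : (0 : ℝ) < n := by exact_mod_cast hn
  rw [← div_le_iff₀' (by positivity), AlgTensor.norm_def]
  refine le_csInf u.costs_nonempty ?_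
  rintro s ⟨m, h, x, rfl, rfl⟩
  rw [div_le_iff₀' (by positivity), map_sum, Finset.mul_sum]
  refine (norm_sum_le _ _).trans (Finset.sum_le_sum fun k _ => ?_)
  rw [paleyForm_tmul]
  exact norm_sum_apply_mul_pairing_le (h k) (x k)

variable (p n) in
/-- The tensor `∑ z ^ (3 ^ (k + 1)) ⊗ e_k`. -/
noncomputable def lacunaryTensor : AlgTensor (Hardy ℂ) (ellp p n) :=
  ∑ k : Fin n, AlgTensor.tmul
    (⟨monomial (3 ^ ((k : ℕ) + 1)) 1, Submodule.le_topologicalClosure _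
      (Submodule.subset_span ⟨(3 ^ ((k : ℕ) + 1), 1), rfl⟩)⟩ : Hardy ℂ) (PiLp.single p k 1)

theorem paleyForm_lacunaryTensor : paleyForm p n (lacunaryTensor p n) = n := by
  rw [lacunaryTensor, map_sum]
  calc _ = ∑ _k : Fin n, (1 : ℂ) := by
        refine Finset.sum_congr rfl fun k _ => ?_
        rw [paleyForm_tmul, Finset.sum_eq_single k (fun b _ hb => by simp [hb]) (by simp)]
        simp [pairing_fourier_monomial]
    _ = n := by simp

/-- At almost every point all coordinates of the function have modulus one, and the circle has total
mass one. -/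
theorem norm_algInclusion_lacunaryTensor_le :
    ‖algInclusion (ellp p n) (lacunaryTensor p n)‖ ≤ (n : ℝ) ^ (1 / p.toReal) := by
  have h1 : (algInclusion (ellp p n) (lacunaryTensor p n) : Lp (ellp p n) 1 circleMeasure) =
      ContinuousMap.toLp 1 circleMeasure ℂ (∑ k : Fin n,
        ⟨fun t : UnitAddCircle => fourier ((3 ^ ((k : ℕ) + 1) : ℕ) : ℤ) t •
          (PiLp.single p k 1 : ellp p n), by fun_prop⟩) := by
    rw [map_sum, lacunaryTensor, map_sum, Submodule.coe_sum]
    refine Finset.sum_congr rfl fun k _ => ?_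
    rw [algInclusion_tmul]
    refine (mulVec_monomial _ _ _).trans ?_
    rw [one_smul]
    rfl
  rw [Submodule.coe_norm, h1]
  refine (Lp.norm_le_of_ae_bound (C := (n : ℝ) ^ (1 / p.toReal)) (by positivity) ?_).trans_eq
    (by simp [measureUnivNNReal])
  filter_upwards [ContinuousMap.coeFn_toLp (p := 1) (𝕜 := ℂ) circleMeasure (∑ k : Fin n,
        (⟨fun t : UnitAddCircle => fourier ((3 ^ ((k : ℕ) + 1) : ℕ) : ℤ) t •
          (PiLp.single p k 1 : ellp p n), by fun_prop⟩ : C(UnitAddCircle, ellp p n)))] with t ht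
  rw [ht]
  refine (ellp_norm_le_of_apply_le zero_le_one fun i => ?_).trans_eq (mul_one _)
  simp [ContinuousMap.sum_apply, Pi.single_apply, Circle.norm_coe]

theorem half_mul_rpow_le_eta (p : ℝ≥0∞) [Fact (1 ≤ p)] (hn : 1 ≤ n) :
    ENNReal.ofReal (1 / 2 * (n : ℝ) ^ (1 - 1 / (min 2 p).toReal)) ≤ eta (ellp p n) := by
  have hn' : (0 : ℝ) < n := by exact_mod_cast hn
  refine le_sInf ?_
  rintro _ ⟨c, rfl, hc⟩
  rw [← ENNReal.ofReal_coe_nnreal]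
  refine ENNReal.ofReal_le_ofReal ?_
  have h1 := hc (lacunaryTensor p n : ProjTensor (Hardy ℂ) (ellp p n))
  rw [inclusion_coe, ProjTensor.norm_coe] at h1
  have h2 := norm_paleyForm_le (p := p) hn (lacunaryTensor p n)
  rw [paleyForm_lacunaryTensor, Complex.norm_natCast] at h2
  -- The factor `n^(1/p)` from the test function cancels the loss `n^(-1/p)` in the bound for the
  -- form, leaving only `r`.
  have h3 : (n : ℝ) ≤ 2 * c * (n : ℝ) ^ (1 / (min 2 p).toReal) :=
    calc (n : ℝ) ≤ _ := h2
      _ ≤ 2 * (n : ℝ) ^ (1 / (min 2 p).toReal - 1 / p.toReal) *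
          (c * (n : ℝ) ^ (1 / p.toReal)) := by
          gcongr
          exact h1.trans (mul_le_mul_of_nonneg_left norm_algInclusion_lacunaryTensor_le c.2)
      _ = 2 * c * (n : ℝ) ^ (1 / (min 2 p).toReal) := by
          rw [Real.rpow_sub hn']
          have := (Real.rpow_pos_of_pos hn' (1 / p.toReal)).ne'
          field_simp
  rw [Real.rpow_sub hn', Real.rpow_one]
  have h4 := Real.rpow_pos_of_pos hn' (1 / (min 2 p).toReal)
  have h5 := (div_le_iff₀ h4).2 h3
  linarith

end LowerBound

end H1Projective

theorem proposition6p2 (p : ENNReal) [Fact (1 ≤ p)] (n : ℕ) (hn : 1 ≤ n) :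
    (1 / 2 : ENNReal) * (n : ENNReal) ^ (1 - 1 / (min 2 p).toReal : ℝ)
        ≤ H1Projective.eta (H1Projective.ellp p n) ∧
      H1Projective.eta (H1Projective.ellp p n)
        ≤ H1Projective.banachMazur (H1Projective.ellp p n) (H1Projective.ellp 1 n) ∧
      H1Projective.banachMazur (H1Projective.ellp p n) (H1Projective.ellp 1 n)
        ≤ (n : ENNReal) ^ (1 - 1 / (min 2 p).toReal : ℝ) := by
  have hcast : (n : ENNReal) ^ (1 - 1 / (min 2 p).toReal : ℝ) =
      ENNReal.ofReal ((n : ℝ) ^ (1 - 1 / (min 2 p).toReal)) := by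
    rw [← ENNReal.ofReal_rpow_of_pos (by exact_mod_cast hn), ENNReal.ofReal_natCast]
  have hhalf : (1 / 2 : ENNReal) = ENNReal.ofReal (1 / 2) := by
    rw [ENNReal.ofReal_div_of_pos two_pos]
    simp
  refine ⟨?_, H1Projective.eta_le_banachMazur n, ?_⟩
  · rw [hcast, hhalf, ← ENNReal.ofReal_mul (by norm_num)]
    exact H1Projective.half_mul_rpow_le_eta p hn
  · rw [hcast]
    exact H1Projective.banachMazur_ellp_le p hn
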